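/- Let $\lambda:\mathbb{R}\to\{z\in\mathbb{C}: |z|=1\}$ be a twice continuously differentiable $2\pi$-periodic function whose derivative $\lambda'$ has at most finitely many zeros in $[0,2\pi)$. Let $m\in\mathbb{Z}$ be the winding number of $\lambda$, and let $\theta:\mathbb{R}\to\mathbb{R}$ be a continuous $2\pi$-periodic function with $\lambda(k)=e^{i(mk+\theta(k))}$ for all $k\in\mathbb{R}$. On the Hilbert space $\mathcal{K}_1=L^2([0,2\pi],dk/2\pi)$ let $Pf=-if'$ with domain $D(P)=\{f\in AC[0,2\pi] : f'\in\mathcal{K}_1,\ f(0)=f(2\pi)\}$, where $AC[0,2\pi]$ is the set of absolutely continuous functions on $[0,2\pi]$, and let $$T=\frac12\left(\frac{1}{m+\theta'(k)}P+P\frac{1}{m+\theta'(k)}\right)$$ with its natural domain (functions of $k$ act as multiplication operators with their maximal domains, $D(AB)=\{f\in D(B): Bf\in D(A)\}$ and $D(A+B)=D(A)\cap D(B)$). Let $\sigma(T)$ be the spectrum of $T$, that is, the set of all $z\in\mathbb{C}$ for which it is not the case that $T-z$ is injective with dense range and bounded inverse on that range. (1) If $\lambda'$ has no zeros, then $m\neq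 0$ and $\sigma(T)=\{s/m : s\in\mathbb{Z}\}$. (2) If $\lambda'$ has a zero, then $\sigma(T)=\mathbb{C}$. -/

import Mathlib

open MeasureTheory Set
open scoped ENNReal

noncomputable section

namespace QuantumWalk

/-- The measure `dk / (2π)` on the interval `[0, 2π]`. -/
def circleMeasure : Measure ℝ :=
  (ENNReal.ofReal (2 * Real.pi))⁻¹ • (volume.restrict (Icc 0 (2 * Real.pi)))

/-- The Hilbert space `L²([0, 2π], dk / (2π))` of complex-valued functions. -/
abbrev K1 : Type := Lp ℂ 2 circleMeasure

/-! ### Unbounded operators -/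

/-- The product `A B` of two unbounded operators with its natural domain
`D(A B) = {x ∈ D(B) | B x ∈ D(A)}`. -/
def opMul {H : Type*} [AddCommGroup H] [Module ℂ H] (A B : H →ₗ.[ℂ] H) : H →ₗ.[ℂ] H where
  domain :=
    { carrier := {x | ∃ hx : x ∈ B.domain, B ⟨x, hx⟩ ∈ A.domain}
      add_mem' := by
        rintro x y ⟨hx, hx'⟩ ⟨hy, hy'⟩
        refine ⟨B.domain.add_mem hx hy, ?_⟩
        have h : B ⟨x + y, B.domain.add_mem hx hy⟩ = B ⟨x, hx⟩ + B ⟨y, hy⟩ :=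
          B.map_add ⟨x, hx⟩ ⟨y, hy⟩
        rw [h]
        exact A.domain.add_mem hx' hy'
      zero_mem' := by
        refine ⟨B.domain.zero_mem, ?_⟩
        have h : B ⟨0, B.domain.zero_mem⟩ = 0 := B.map_zero
        rw [h]
        exact A.domain.zero_mem
      smul_mem' := by
        rintro c x ⟨hx, hx'⟩
        refine ⟨B.domain.smul_mem c hx, ?_⟩
        have h : B ⟨c • x, B.domain.smul_mem c hx⟩ = c • B ⟨x, hx⟩ := B.map_smul c ⟨x, hx⟩
        rw [h]
        exact A.domain.smul_mem c hx' }
  toFun :=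
    { toFun := fun x => A ⟨B ⟨x.1, x.2.choose⟩, x.2.choose_spec⟩
      map_add' := by
        intro x y
        rw [← A.map_add]
        congr 1
        exact Subtype.ext (B.map_add ⟨x.1, x.2.choose⟩ ⟨y.1, y.2.choose⟩)
      map_smul' := by
        intro c x
        rw [RingHom.id_apply, ← A.map_smul]
        congr 1
        exact Subtype.ext (B.map_smul c ⟨x.1, x.2.choose⟩) }

/-- The resolvent set of an unbounded operator `A` on a complex normed space: the set of `z` such
that `A - z` has dense range and is bounded below, that is, `A - z` is injective and its inverse,
defined on the dense range, is bounded. If `A` is a closed operator on a Hilbert space, the range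
is then the whole space, so that `(A - z)⁻¹` is an everywhere defined bounded operator.
For closable `A` the resolvent set is that of the closure of `A`. -/
def resolvent {H : Type*} [NormedAddCommGroup H] [NormedSpace ℂ H] (A : H →ₗ.[ℂ] H) : Set ℂ :=
  {z | DenseRange (fun x : A.domain => A x - z • (x : H)) ∧
    ∃ c : ℝ, 0 < c ∧ ∀ x : A.domain, c * ‖(x : H)‖ ≤ ‖A x - z • (x : H)‖}

/-- The spectrum `σ(A)` of an unbounded operator, the complement of the resolvent set. -/
def opSpectrum {H : Type*} [NormedAddCommGroup H] [NormedSpace ℂ H] (A : H →ₗ.[ℂ] H) : Set ℂ :=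
  (resolvent A)ᶜ

/-! ### Multiplication operators -/

/-- The operator of multiplication by `φ` with its natural domain
`{f ∈ L² | φ f ∈ L²}`. -/
def mulOp (φ : ℝ → ℂ) : K1 →ₗ.[ℂ] K1 where
  domain :=
    { carrier := {f | MemLp (fun k => φ k * f k) 2 circleMeasure}
      add_mem' := by
        intro f g hf hg
        refine (hf.add hg).ae_eq ?_
        filter_upwards [Lp.coeFn_add f g] with k hk
        simp only [Pi.add_apply, hk, mul_add]
      zero_mem' := by
        refine (MemLp.zero (ε := ℂ)).ae_eq ?_
        filter_upwards [Lp.coeFn_zero ℂ 2 circleMeasure] with k hk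
        have hk' : (0 : K1) k = 0 := hk
        exact (mul_eq_zero_of_right (φ k) hk').symm
      smul_mem' := by
        intro c f hf
        refine (hf.const_smul c).ae_eq ?_
        filter_upwards [Lp.coeFn_smul c f] with k hk
        simp only [Pi.smul_apply, hk, smul_eq_mul]
        ring }
  toFun :=
    { toFun := fun f => MemLp.toLp (fun k => φ k * f.1 k) f.2
      map_add' := by
        intro f g
        rw [← MemLp.toLp_add, MemLp.toLp_eq_toLp_iff]
        filter_upwards [Lp.coeFn_add f.1 g.1] with k hk
        simp only [Pi.add_apply, Submodule.coe_add, hk, mul_add]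
      map_smul' := by
        intro c f
        rw [RingHom.id_apply, ← MemLp.toLp_const_smul, MemLp.toLp_eq_toLp_iff]
        filter_upwards [Lp.coeFn_smul c f.1] with k hk
        simp only [Pi.smul_apply, Submodule.coe_smul, hk, smul_eq_mul]
        ring }

/-! ### The momentum operator with periodic boundary condition -/

/-- `F` is a periodic absolutely continuous representative of `f` with square-integrable
derivative: `F ∈ AC[0, 2π]`, `F(0) = F(2π)`, `F' ∈ L²` and `f = F` almost everywhere. -/
structure IsACRep (f : K1) (F : ℝ → ℂ) : Prop where
  ac : AbsolutelyContinuousOnInterval F 0 (2 * Real.pi)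
  periodic : F 0 = F (2 * Real.pi)
  deriv_memLp : MemLp (deriv F) 2 circleMeasure
  ae_eq : f =ᵐ[circleMeasure] F

theorem ae_circleMeasure_iff {p : ℝ → Prop} :
    (∀ᵐ k ∂circleMeasure, p k) ↔ ∀ᵐ k ∂(volume.restrict (Ioo 0 (2 * Real.pi))), p k := by
  have h0 : (ENNReal.ofReal (2 * Real.pi))⁻¹ ≠ 0 :=
    ENNReal.inv_ne_zero.mpr ENNReal.ofReal_ne_top
  rw [circleMeasure, Measure.ae_ennreal_smul_measure_iff h0, restrict_Ioo_eq_restrict_Icc]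

theorem ac_ae_differentiableAt {F : ℝ → ℂ}
    (hF : AbsolutelyContinuousOnInterval F 0 (2 * Real.pi)) :
    ∀ᵐ k ∂circleMeasure, DifferentiableAt ℝ F k := by
  rw [ae_circleMeasure_iff, ae_restrict_iff' measurableSet_Ioo]
  have hbv := hF.boundedVariationOn.locallyBoundedVariationOn
  rw [uIcc_of_le Real.two_pi_pos.le] at hbv
  filter_upwards [hbv.ae_differentiableWithinAt_of_mem] with k hk hk'
  exact (hk (Ioo_subset_Icc_self hk')).differentiableAt (Icc_mem_nhds hk'.1 hk'.2)

/-- Absolutely continuous functions that agree almost everywhere on `[0, 2π]` have the same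
derivative almost everywhere on `[0, 2π]`. -/
theorem ac_deriv_congr {F G : ℝ → ℂ} (hF : AbsolutelyContinuousOnInterval F 0 (2 * Real.pi))
    (hG : AbsolutelyContinuousOnInterval G 0 (2 * Real.pi)) (h : F =ᵐ[circleMeasure] G) :
    deriv F =ᵐ[circleMeasure] deriv G := by
  have hFc := hF.continuousOn
  have hGc := hG.continuousOn
  rw [uIcc_of_le Real.two_pi_pos.le] at hFc hGc
  have heq : EqOn F G (Ioo 0 (2 * Real.pi)) :=
    Measure.eqOn_open_of_ae_eq (ae_circleMeasure_iff.mp h) isOpen_Ioo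
      (hFc.mono Ioo_subset_Icc_self) (hGc.mono Ioo_subset_Icc_self)
  refine ae_circleMeasure_iff.mpr ?_
  rw [ae_restrict_iff' measurableSet_Ioo]
  filter_upwards with k hk
  exact (heq.eventuallyEq_of_mem (isOpen_Ioo.mem_nhds hk)).deriv_eq

theorem deriv_add_ae {F G : ℝ → ℂ} (hF : AbsolutelyContinuousOnInterval F 0 (2 * Real.pi))
    (hG : AbsolutelyContinuousOnInterval G 0 (2 * Real.pi)) :
    deriv (F + G) =ᵐ[circleMeasure] deriv F + deriv G := by
  filter_upwards [ac_ae_differentiableAt hF, ac_ae_differentiableAt hG] with k h1 h2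
  exact deriv_add h1 h2

theorem deriv_smul_ae {F : ℝ → ℂ} (c : ℂ)
    (hF : AbsolutelyContinuousOnInterval F 0 (2 * Real.pi)) :
    deriv (c • F) =ᵐ[circleMeasure] c • deriv F := by
  filter_upwards [ac_ae_differentiableAt hF] with k h1
  exact deriv_const_smul c h1

theorem IsACRep.add {f g : K1} {F G : ℝ → ℂ} (hF : IsACRep f F) (hG : IsACRep g G) :
    IsACRep (f + g) (F + G) where
  ac := hF.ac.add hG.ac
  periodic := by simp only [Pi.add_apply, hF.periodic, hG.periodic]
  deriv_memLp := (hF.deriv_memLp.add hG.deriv_memLp).ae_eq (deriv_add_ae hF.ac hG.ac).symm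
  ae_eq := (Lp.coeFn_add f g).trans (hF.ae_eq.add hG.ae_eq)

theorem IsACRep.smul {f : K1} {F : ℝ → ℂ} (c : ℂ) (hF : IsACRep f F) :
    IsACRep (c • f) (c • F) where
  ac := hF.ac.const_smul c
  periodic := by simp only [Pi.smul_apply, hF.periodic]
  deriv_memLp := (hF.deriv_memLp.const_smul c).ae_eq (deriv_smul_ae c hF.ac).symm
  ae_eq := (Lp.coeFn_smul c f).trans (hF.ae_eq.const_smul c)

theorem IsACRep.zero : IsACRep 0 0 where
  ac := ((LipschitzWith.const (0 : ℂ)).lipschitzOnWith (K := 0)).absolutelyContinuousOnInterval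
  periodic := rfl
  deriv_memLp := by
    have h : deriv (0 : ℝ → ℂ) = 0 := deriv_zero
    rw [h]
    exact MemLp.zero
  ae_eq := Lp.coeFn_zero ℂ 2 circleMeasure

/-- The operator `P f = -i f'` on `L²([0, 2π], dk / (2π))` with domain
`D(P) = {f ∈ AC[0, 2π] | f' ∈ L², f(0) = f(2π)}`. -/
def momentum : K1 →ₗ.[ℂ] K1 where
  domain :=
    { carrier := {f | ∃ F : ℝ → ℂ, IsACRep f F}
      add_mem' := by
        rintro f g ⟨F, hF⟩ ⟨G, hG⟩
        exact ⟨F + G, hF.add hG⟩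
      zero_mem' := ⟨0, IsACRep.zero⟩
      smul_mem' := by
        rintro c f ⟨F, hF⟩
        exact ⟨c • F, hF.smul c⟩ }
  toFun :=
    { toFun := fun f => (-Complex.I) • MemLp.toLp (deriv f.2.choose) f.2.choose_spec.deriv_memLp
      map_add' := by
        intro f g
        rw [← smul_add, ← MemLp.toLp_add]
        refine congrArg (fun u : K1 => (-Complex.I) • u) ?_
        rw [MemLp.toLp_eq_toLp_iff]
        have h1 := (f + g).2.choose_spec
        have h2 := f.2.choose_spec.add g.2.choose_spec
        exact (ac_deriv_congr h1.ac h2.ac (h1.ae_eq.symm.trans h2.ae_eq)).trans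
          (deriv_add_ae f.2.choose_spec.ac g.2.choose_spec.ac)
      map_smul' := by
        intro c f
        rw [RingHom.id_apply, smul_comm]
        refine congrArg (fun u : K1 => (-Complex.I) • u) ?_
        rw [← MemLp.toLp_const_smul, MemLp.toLp_eq_toLp_iff]
        have h1 := (c • f).2.choose_spec
        have h2 := f.2.choose_spec.smul c
        exact (ac_deriv_congr h1.ac h2.ac (h1.ae_eq.symm.trans h2.ae_eq)).trans
          (deriv_smul_ae c f.2.choose_spec.ac) }

/-! ### Winding number and time operator -/

/-- `m` is the winding number of the `2π`-periodic function `lam`, and `θ` is a continuous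
`2π`-periodic real function with `lam k = exp (i (m k + θ k))` for all `k`. -/
structure IsWindingData (lam : ℝ → ℂ) (m : ℤ) (θ : ℝ → ℝ) : Prop where
  continuous : Continuous θ
  periodic : Function.Periodic θ (2 * Real.pi)
  eq_exp : ∀ k : ℝ, lam k = Complex.exp (Complex.I * ((m * k + θ k : ℝ) : ℂ))

/-- The operator `T = (1/2) ((1 / (m + θ')) P + P (1 / (m + θ')))` with its natural domain. -/
def timeOp (m : ℤ) (θ : ℝ → ℝ) : K1 →ₗ.[ℂ] K1 :=
  (1 / 2 : ℂ) •
    (opMul (mulOp fun k => ((1 / (m + deriv θ k) : ℝ) : ℂ)) momentum +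
      opMul momentum (mulOp fun k => ((1 / (m + deriv θ k) : ℝ) : ℂ)))

end QuantumWalk

end

/-!
Write `φ k = m k + θ k` and `v = φ' = m + θ'`. Since `lam = exp (i φ)` is `C²` and a continuous phase
is locally a branch of the logarithm, `φ` is `C²` and `v` is `C¹`; moreover `lam' = i v lam`, so the
zeros of `lam'` are those of `v`.

A function `f` in the domain of `T` is `f = v G` with `G` absolutely continuous and
`G(0) = G(2π)`. With the integrating factor `ρ = √|v| exp(-i z φ)`, the equation for
`h = (T - z) f` becomes `ρ h = -i (ρ G)'` away from the zeros of `v`. Since `ρ G` is continuous and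
the zeros are finitely many, it integrates to `∫₀ˣ ρ h = -i (ρ(x) G(x) - ρ(0) G(0))` for all `x`
(`exists_continuous_quotient`). Everything follows from this identity and from
`exp(2π i z m) ρ(2π) = ρ(0)`.

* If `exp(2π i z m) = 1`, then `ρ` annihilates the range of `T - z`, which is therefore not dense
  (`mem_opSpectrum_of_exp_eq_one`).
* If `v` has a zero `k₀`, then `ρ` vanishes there, and `ρ` may be multiplied by `exp(2π i z m)` on
  `(k₀, 2π]` without creating a boundary term at `k₀`; the result annihilates the range of `T - z`
  for every `z` (`mem_opSpectrum_of_zero`).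
* If `v` has no zeros and `exp(2π i z m) ≠ 1`, the boundary condition determines `ρ(0) G(0)` from
  `h`. This bounds `f` by `h`, and variation of constants solves `(T - z) f = h` for every
  continuous `h`; continuous functions are dense (`mem_resolvent_of_exp_ne_one`).
-/

/-! ### Absolutely continuous complex-valued functions -/

namespace AbsolutelyContinuousOnInterval

theorem comp_lipschitzWith {X Y : Type*} [PseudoMetricSpace X] [PseudoMetricSpace Y]
    {f : ℝ → X} {g : X → Y} {K : NNReal} {a b : ℝ} (hg : LipschitzWith K g)
    (hf : AbsolutelyContinuousOnInterval f a b) :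
    AbsolutelyContinuousOnInterval (fun x => g (f x)) a b := by
  apply squeeze_zero (fun t => ?_) (fun t => ?_)
    (by simpa using Filter.Tendsto.const_mul (K : ℝ) hf)
  · exact Finset.sum_nonneg (fun i hi => by positivity)
  · rw [Finset.mul_sum]
    gcongr
    exact hg.dist_le_mul _ _

/-- The fundamental theorem of calculus for a complex-valued absolutely continuous function,
obtained from the real one for the real and imaginary parts. -/
theorem integral_eq_sub_of_ae_hasDerivAt {f g : ℝ → ℂ} {a b : ℝ}
    (hf : AbsolutelyContinuousOnInterval f a b)
    (hg : IntervalIntegrable g volume a b)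
    (hfg : ∀ᵐ x, x ∈ uIcc a b → HasDerivAt f (g x) x) :
    ∫ x in a..b, g x = f b - f a := by
  have aux : ∀ l : ℂ →L[ℝ] ℝ, l (∫ x in a..b, g x) = l (f b - f a) := by
    intro l
    rw [← ContinuousLinearMap.intervalIntegral_comp_comm _ hg, map_sub,
      ← (hf.comp_lipschitzWith l.lipschitz).integral_deriv_eq_sub]
    apply intervalIntegral.integral_congr_ae
    filter_upwards [hfg] with x hx hx'
    exact (l.hasFDerivAt.comp_hasDerivAt x (hx (uIoc_subset_uIcc hx'))).deriv.symm
  exact Complex.ext (aux Complex.reCLM) (aux Complex.imCLM)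

end AbsolutelyContinuousOnInterval

/-- The fundamental theorem of calculus for a continuous function that is absolutely continuous
only near each point outside a countable set `s`. The function minus the primitive of its
derivative is locally constant off `s`, hence constant. -/
theorem integral_eq_sub_of_local_absolutelyContinuous {f g : ℝ → ℂ} {a b : ℝ} (hab : a ≤ b)
    {s : Set ℝ} (hs : s.Countable) (hc : ContinuousOn f (Icc a b))
    (hg : IntervalIntegrable g volume a b)
    (hfg : ∀ᵐ x, x ∈ Ioo a b → HasDerivAt f (g x) x)
    (hac : ∀ x ∈ Ioo a b \ s, ∃ c d, x ∈ Ioo c d ∧ Icc c d ⊆ Ioo a b ∧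
      AbsolutelyContinuousOnInterval f c d) :
    ∫ x in a..b, g x = f b - f a := by
  have hcont : ContinuousOn (fun y => f y - ∫ x in a..y, g x) (Icc a b) :=
    hc.sub (intervalIntegral.continuousOn_primitive_interval'
      hg left_mem_uIcc |>.mono (by rw [uIcc_of_le hab]))
  have hsub : ∀ {c d}, c ∈ Icc a b → d ∈ Icc a b → IntervalIntegrable g volume c d := by
    intro c d hc hd
    refine hg.mono_set ?_
    rw [uIcc_of_le hab]
    exact uIcc_subset_Icc hc hd
  have hder : ∀ x ∈ Ioo a b \ s, HasDerivAt (fun y => f y - ∫ x in a..y, g x) 0 x := by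
    intro x hx
    obtain ⟨c, d, hxcd, hcd, hf⟩ := hac x hx
    have hcd' : c ≤ d := (hxcd.1.trans hxcd.2).le
    have hcm := Ioo_subset_Icc_self (hcd (left_mem_Icc.2 hcd'))
    have key : ∀ y ∈ Ioo c d, f y - ∫ x in a..y, g x = f c - ∫ x in a..c, g x := by
      intro y hy
      have hym := Ioo_subset_Icc_self (hcd (Ioo_subset_Icc_self hy))
      have hsubset : uIcc c y ⊆ Icc c d := by
        rw [uIcc_of_le hy.1.le]; exact Icc_subset_Icc_right hy.2.le
      have h1 := (hf.mono (c := c) (d := y)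
        (by rwa [uIcc_of_le hcd'])).integral_eq_sub_of_ae_hasDerivAt (hsub hcm hym) (by
          filter_upwards [hfg] with t ht ht'
          exact ht (hcd (hsubset ht')))
      rw [← intervalIntegral.integral_add_adjacent_intervals
        (hsub (left_mem_Icc.2 hab) hcm) (hsub hcm hym), h1]
      ring
    refine (hasDerivAt_const x (f c - ∫ x in a..c, g x)).congr_of_eventuallyEq ?_
    filter_upwards [Ioo_mem_nhds hxcd.1 hxcd.2] with y hy using key y hy
  have := integral_eq_of_hasDerivAt_off_countable_of_le _ (fun _ => (0 : ℂ)) hab hs hcont hder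
    (by simp)
  simp only [intervalIntegral.integral_zero, intervalIntegral.integral_same, sub_zero] at this
  linear_combination this

noncomputable section

namespace QuantumWalk

/-! ### The measure on the circle -/

theorem ae_circleMeasure_iff_volume {p : ℝ → Prop} :
    (∀ᵐ k ∂circleMeasure, p k) ↔ ∀ᵐ k, k ∈ Ioo 0 (2 * Real.pi) → p k := by
  rw [ae_circleMeasure_iff, ae_restrict_iff' measurableSet_Ioo]

instance isProbabilityMeasure_circleMeasure : IsProbabilityMeasure circleMeasure := by
  constructor
  rw [circleMeasure, Measure.smul_apply, Measure.restrict_apply_univ, Real.volume_Icc, sub_zero,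
    smul_eq_mul]
  exact ENNReal.inv_mul_cancel (by simp [Real.pi_pos]) ENNReal.ofReal_ne_top

theorem integrable_circleMeasure_iff {f : ℝ → ℂ} :
    Integrable f circleMeasure ↔ IntervalIntegrable f volume 0 (2 * Real.pi) := by
  rw [intervalIntegrable_iff_integrableOn_Icc_of_le Real.two_pi_pos.le, circleMeasure,
    integrable_smul_measure (ENNReal.inv_ne_zero.mpr ENNReal.ofReal_ne_top)
      (ENNReal.inv_ne_top.mpr (by simp [Real.pi_pos])), IntegrableOn]

theorem integral_circleMeasure (f : ℝ → ℂ) :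
    ∫ k, f k ∂circleMeasure = ((2 * Real.pi)⁻¹ : ℝ) • ∫ k in 0..2 * Real.pi, f k := by
  rw [circleMeasure, integral_smul_measure, intervalIntegral.integral_of_le Real.two_pi_pos.le,
    integral_Icc_eq_integral_Ioc, ENNReal.toReal_inv, ENNReal.toReal_ofReal Real.two_pi_pos.le]

theorem ae_ne_zero_of_countable {v : ℝ → ℝ} (hZ : {k ∈ Icc 0 (2 * Real.pi) | v k = 0}.Countable) :
    ∀ᵐ k ∂circleMeasure, v k ≠ 0 := by
  rw [ae_circleMeasure_iff_volume]
  filter_upwards [(compl_mem_ae_iff.2 (hZ.measure_zero volume))] with k hk hk' h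
  exact hk ⟨Ioo_subset_Icc_self hk', h⟩

/-! ### The symmetrised operator and its domain -/

/-- The operator `(1/2) ((1/v) P + P (1/v))` with its natural domain. At a zero of `v` the
multiplier takes the value `1 / 0 = 0`, which is immaterial when the zeros form a null set. -/
def symOp (v : ℝ → ℝ) : K1 →ₗ.[ℂ] K1 :=
  (1 / 2 : ℂ) •
    (opMul (mulOp fun k => ((1 / v k : ℝ) : ℂ)) momentum +
      opMul momentum (mulOp fun k => ((1 / v k : ℝ) : ℂ)))

theorem momentum_apply_ae {f : K1} {F : ℝ → ℂ} (hF : IsACRep f F) (hf : f ∈ momentum.domain) :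
    momentum ⟨f, hf⟩ =ᵐ[circleMeasure] fun k => -Complex.I * deriv F k := by
  have h1 := hf.choose_spec
  have h2 : momentum ⟨f, hf⟩ = (-Complex.I) • MemLp.toLp _ h1.deriv_memLp := rfl
  rw [h2]
  filter_upwards [Lp.coeFn_smul (-Complex.I) (MemLp.toLp _ h1.deriv_memLp),
    h1.deriv_memLp.coeFn_toLp, ac_deriv_congr h1.ac hF.ac (h1.ae_eq.symm.trans hF.ae_eq)]
    with k h3 h4 h5
  rw [h3, Pi.smul_apply, h4, h5, smul_eq_mul]

theorem mulOp_apply_ae {p : ℝ → ℂ} (f : (mulOp p).domain) :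
    mulOp p f =ᵐ[circleMeasure] fun k => p k * (f : K1) k :=
  MemLp.coeFn_toLp (f := fun k => p k * (f : K1) k) f.2

theorem mem_symOp_domain {v : ℝ → ℝ} {f : K1} :
    f ∈ (symOp v).domain ↔
      (∃ hf : f ∈ momentum.domain,
        momentum ⟨f, hf⟩ ∈ (mulOp fun k => ((1 / v k : ℝ) : ℂ)).domain) ∧
      ∃ hf : f ∈ (mulOp fun k => ((1 / v k : ℝ) : ℂ)).domain,
        mulOp (fun k => ((1 / v k : ℝ) : ℂ)) ⟨f, hf⟩ ∈ momentum.domain := Iff.rfl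

/-- The values of `symOp v` in terms of absolutely continuous representatives of `f` and
of `f / v`. -/
theorem symOp_apply_ae {v : ℝ → ℝ} (f : (symOp v).domain) {F G : ℝ → ℂ}
    (hF : IsACRep f F)
    (hG : IsACRep (mulOp (fun k => ((1 / v k : ℝ) : ℂ))
      ⟨f, (mem_symOp_domain.1 f.2).2.choose⟩) G) :
    symOp v f =ᵐ[circleMeasure] fun k =>
      -Complex.I / 2 * (((1 / v k : ℝ) : ℂ) * deriv F k + deriv G k) := by
  obtain ⟨⟨h1, h1'⟩, ⟨h2, h2'⟩⟩ := mem_symOp_domain.1 f.2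
  have h : symOp v f = (1 / 2 : ℂ) •
      (mulOp (fun k => ((1 / v k : ℝ) : ℂ)) ⟨momentum ⟨f, h1⟩, h1'⟩ +
        momentum ⟨mulOp (fun k => ((1 / v k : ℝ) : ℂ)) ⟨f, h2⟩, h2'⟩) := rfl
  rw [h]
  filter_upwards [Lp.coeFn_smul (1 / 2 : ℂ)
      (mulOp (fun k => ((1 / v k : ℝ) : ℂ)) ⟨momentum ⟨f, h1⟩, h1'⟩ +
        momentum ⟨mulOp (fun k => ((1 / v k : ℝ) : ℂ)) ⟨f, h2⟩, h2'⟩),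
    Lp.coeFn_add (mulOp (fun k => ((1 / v k : ℝ) : ℂ)) ⟨momentum ⟨f, h1⟩, h1'⟩)
      (momentum ⟨mulOp (fun k => ((1 / v k : ℝ) : ℂ)) ⟨f, h2⟩, h2'⟩),
    mulOp_apply_ae ⟨momentum ⟨f, h1⟩, h1'⟩, momentum_apply_ae hF h1, momentum_apply_ae hG h2']
    with k a1 a2 a3 a4 a5
  rw [a1, Pi.smul_apply, a2, Pi.add_apply, a3, a5, smul_eq_mul]
  simp only [a4]
  ring

/-! ### The integrating factor -/

/-- The integrating factor `√|v| exp(-i z φ)` of the equation `(T - z) f = h`, where `φ' = v`. -/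
def phaseWeight (v φ : ℝ → ℝ) (z : ℂ) (k : ℝ) : ℂ :=
  (Real.sqrt |v k| : ℂ) * Complex.exp (-(Complex.I * z * φ k))

section phaseWeight

variable {v φ : ℝ → ℝ} {z : ℂ} {k : ℝ}

theorem phaseWeight_ne_zero (hk : v k ≠ 0) : phaseWeight v φ z k ≠ 0 :=
  mul_ne_zero (by simpa [Real.sqrt_eq_zero'] using hk) (Complex.exp_ne_zero _)

theorem phaseWeight_eq_zero (hk : v k = 0) : phaseWeight v φ z k = 0 := by
  simp [phaseWeight, hk]

/-- With `Real.log v = log |v|`, the square root of `|v|` is `exp (log v / 2)`, which is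
differentiable for both signs of `v`. -/
theorem phaseWeight_eq_exp (hk : v k ≠ 0) :
    phaseWeight v φ z k =
      Complex.exp (((Real.log (v k) / 2 : ℝ) : ℂ) - Complex.I * z * φ k) := by
  rw [phaseWeight, sub_eq_add_neg, Complex.exp_add, ← Complex.ofReal_exp,
    ← Real.log_abs, ← Real.log_sqrt (abs_nonneg _),
    Real.exp_log (Real.sqrt_pos.2 (abs_pos.2 hk))]

theorem continuous_phaseWeight (hv : Continuous v) (hφ : Continuous φ) :
    Continuous (phaseWeight v φ z) := by
  unfold phaseWeight
  fun_prop

theorem phaseWeight_eventuallyEq (hv : Continuous v) (hk : v k ≠ 0) :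
    phaseWeight v φ z =ᶠ[nhds k]
      fun x => Complex.exp (((Real.log (v x) / 2 : ℝ) : ℂ) - Complex.I * z * φ x) := by
  filter_upwards [hv.continuousAt.eventually_ne hk] with x hx using phaseWeight_eq_exp hx

theorem hasDerivAt_phaseWeight (hv : ContDiff ℝ 1 v) (hφ : ∀ k, HasDerivAt φ (v k) k)
    (hk : v k ≠ 0) :
    HasDerivAt (phaseWeight v φ z)
      (phaseWeight v φ z k * (((deriv v k / v k / 2 : ℝ) : ℂ) - Complex.I * z * v k)) k := by
  refine HasDerivAt.congr_of_eventuallyEq ?_ (phaseWeight_eventuallyEq hv.continuous hk)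
  rw [phaseWeight_eq_exp hk]
  have h1 := ((((hv.differentiable one_ne_zero) k).hasDerivAt.log hk).div_const 2).ofReal_comp
  exact (h1.sub (((hφ k).ofReal_comp).const_mul (Complex.I * z))).cexp

theorem contDiffAt_phaseWeight (hv : ContDiff ℝ 1 v) (hφ : ContDiff ℝ 1 φ) (hk : v k ≠ 0) :
    ContDiffAt ℝ 1 (phaseWeight v φ z) k := by
  refine ContDiffAt.congr_of_eventuallyEq ?_ (phaseWeight_eventuallyEq hv.continuous hk)
  have h1 : ContDiffAt ℝ 1 (fun x => ((Real.log (v x) / 2 : ℝ) : ℂ)) k :=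
    Complex.ofRealCLM.contDiff.contDiffAt.comp k ((hv.contDiffAt.log hk).div_const 2)
  have h2 : ContDiffAt ℝ 1 (fun x => (φ x : ℂ)) k :=
    Complex.ofRealCLM.contDiff.contDiffAt.comp k hφ.contDiffAt
  exact (h1.sub (contDiffAt_const.mul h2)).cexp

theorem contDiff_one_of_hasDerivAt (hv : Continuous v) (hφ : ∀ k, HasDerivAt φ (v k) k) :
    ContDiff ℝ 1 φ := by
  rw [contDiff_one_iff_deriv]
  refine ⟨fun k => (hφ k).differentiableAt, ?_⟩
  rwa [show deriv φ = v from funext fun k => (hφ k).deriv]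

end phaseWeight

/-! ### The integrated form of the eigenvalue equation -/

theorem intervalIntegrable_continuous_mul {p : ℝ → ℂ} (hp : Continuous p) (h : K1) :
    IntervalIntegrable (fun k => p k * h k) volume 0 (2 * Real.pi) :=
  (integrable_circleMeasure_iff.1 ((Lp.memLp h).integrable one_le_two)).continuousOn_mul
    hp.continuousOn

theorem coeFn_sub_smul (a b : K1) (z : ℂ) :
    (a - z • b : K1) =ᵐ[circleMeasure] fun k => a k - z * b k := by
  filter_upwards [Lp.coeFn_sub a (z • b), Lp.coeFn_smul z b] with k h1 h2
  rw [h1, Pi.sub_apply, h2, Pi.smul_apply, smul_eq_mul]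

/-- A function `f` in the domain of `T` has the form `v G` with `G` continuous and
`G(0) = G(2π)`, and the equation for `(T - z) f` reads
`phaseWeight * (T - z) f = -i (phaseWeight * G)'`. In integrated form this persists across the
zeros of `v`, because `phaseWeight * G` is continuous. -/
theorem exists_continuous_quotient {v φ : ℝ → ℝ} (hv : ContDiff ℝ 1 v)
    (hφ : ∀ k, HasDerivAt φ (v k) k)
    (hZ : {k ∈ Icc 0 (2 * Real.pi) | v k = 0}.Countable) (z : ℂ) (f : (symOp v).domain) :
    ∃ G : ℝ → ℂ, ContinuousOn G (Icc 0 (2 * Real.pi)) ∧ G 0 = G (2 * Real.pi) ∧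
      (f : K1) =ᵐ[circleMeasure] (fun k => v k * G k) ∧
      ∀ x ∈ Icc 0 (2 * Real.pi),
        ∫ k in 0..x, phaseWeight v φ z k * (symOp v f - z • (f : K1) : K1) k =
          -Complex.I * (phaseWeight v φ z x * G x - phaseWeight v φ z 0 * G 0) := by
  have hφ1 : ContDiff ℝ 1 φ := contDiff_one_of_hasDerivAt hv.continuous hφ
  obtain ⟨⟨h1, h1'⟩, ⟨h2, h2'⟩⟩ := mem_symOp_domain.1 f.2
  obtain ⟨F, hF⟩ := h1
  obtain ⟨G, hG⟩ := h2'
  have hT := symOp_apply_ae f hF hG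
  have hGc : ContinuousOn G (Icc 0 (2 * Real.pi)) := by
    simpa only [uIcc_of_le Real.two_pi_pos.le] using hG.ac.continuousOn
  have hv0 := ae_ne_zero_of_countable hZ
  have hfG : (f : K1) =ᵐ[circleMeasure] (fun k => v k * G k) := by
    filter_upwards [hv0, mulOp_apply_ae ⟨f, h2⟩, hG.ae_eq] with k a1 a2 a3
    rw [← a3, a2]
    have : (v k : ℂ) ≠ 0 := by exact_mod_cast a1
    push_cast
    field_simp
  have hvac : AbsolutelyContinuousOnInterval (fun k => (v k : ℂ)) 0 (2 * Real.pi) :=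
    (Complex.ofRealCLM.contDiff.comp hv).contDiffOn.absolutelyContinuousOnInterval
  -- The equation `(T - z) f = -i (G' + v' G / (2 v) - i z v G)` almost everywhere.
  have hderiv : ∀ᵐ k ∂circleMeasure,
      HasDerivAt (fun k => phaseWeight v φ z k * G k)
        (Complex.I * (phaseWeight v φ z k * (symOp v f - z • (f : K1) : K1) k)) k := by
    filter_upwards [hv0, hT, hfG, coeFn_sub_smul (symOp v f) f z, ac_ae_differentiableAt hG.ac,
      ac_deriv_congr hF.ac (hvac.fun_smul hG.ac) (hF.ae_eq.symm.trans hfG)]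
      with k a1 a2 a3 a4 a5 a6
    have hvk : HasDerivAt (fun k => (v k : ℂ)) (deriv v k : ℝ) k :=
      ((hv.differentiable one_ne_zero) k).hasDerivAt.ofReal_comp
    have hF' : deriv F k = (deriv v k : ℝ) * G k + v k * deriv G k := by
      rw [a6]; exact (hvk.mul a5.hasDerivAt).deriv
    convert! (hasDerivAt_phaseWeight (z := z) hv hφ a1).mul a5.hasDerivAt using 1
    rw [a4, a2, a3, hF']
    have : (v k : ℂ) ≠ 0 := by exact_mod_cast a1
    push_cast
    field_simp
    ring_nf
    simp only [Complex.I_sq]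
    ring
  refine ⟨G, hGc, hG.periodic, hfG, fun x hx => ?_⟩
  have hcont := continuous_phaseWeight (z := z) hv.continuous hφ1.continuous
  have hint : IntervalIntegrable
      (fun k => phaseWeight v φ z k * (symOp v f - z • (f : K1) : K1) k) volume 0 x := by
    refine (intervalIntegrable_continuous_mul hcont _).mono_set ?_
    rw [uIcc_of_le hx.1, uIcc_of_le Real.two_pi_pos.le]
    exact Icc_subset_Icc_right hx.2
  have main := integral_eq_sub_of_local_absolutelyContinuous hx.1 hZ
    (hcont.continuousOn.mul (hGc.mono (Icc_subset_Icc_right hx.2)))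
    (hint.const_mul Complex.I) (by
      filter_upwards [ae_circleMeasure_iff_volume.1 hderiv] with k hk hk'
      exact hk ⟨hk'.1, hk'.2.trans_le hx.2⟩) (by
      rintro y ⟨hy, hy'⟩
      have hvy : v y ≠ 0 := fun h => hy' ⟨⟨hy.1.le, hy.2.le.trans hx.2⟩, h⟩
      obtain ⟨K, t, ht, hKt⟩ :=
        (contDiffAt_phaseWeight (z := z) hv hφ1 hvy).exists_lipschitzOnWith
      obtain ⟨ε, hε, hεt⟩ := Metric.nhds_basis_closedBall.mem_iff.1
        (Filter.inter_mem ht (Ioo_mem_nhds hy.1 hy.2))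
      rw [Real.closedBall_eq_Icc] at hεt
      have hle : y - ε ≤ y + ε := by linarith
      refine ⟨y - ε, y + ε, ⟨by linarith, by linarith⟩, hεt.trans inter_subset_right, ?_⟩
      have hLip : LipschitzOnWith K (phaseWeight v φ z) (uIcc (y - ε) (y + ε)) := by
        rw [uIcc_of_le hle]; exact hKt.mono (hεt.trans inter_subset_left)
      refine hLip.absolutelyContinuousOnInterval.fun_smul (hG.ac.mono ?_)
      rw [uIcc_of_le hle, uIcc_of_le Real.two_pi_pos.le]
      exact (hεt.trans inter_subset_right).trans
        (Ioo_subset_Icc_self.trans (Icc_subset_Icc_right hx.2)))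
  rw [intervalIntegral.integral_const_mul, Pi.mul_apply, Pi.mul_apply] at main
  linear_combination (-Complex.I) * main +
    (∫ k in 0..x, phaseWeight v φ z k * (symOp v f - z • (f : K1) : K1) k) * Complex.I_sq

/-! ### Points of the spectrum -/

/-- If some nonzero `q` annihilates the range of `A - z`, then `z` lies in the spectrum. -/
theorem mem_opSpectrum_of_annihilator {A : K1 →ₗ.[ℂ] K1} {z : ℂ} {q : ℝ → ℂ}
    (hq : MemLp q 2 circleMeasure) (hq0 : ¬ q =ᵐ[circleMeasure] 0)
    (h : ∀ f : A.domain, ∫ k, q k * (A f - z • (f : K1) : K1) k ∂circleMeasure = 0) :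
    z ∈ opSpectrum A := by
  rintro ⟨hd, -⟩
  set g : K1 := (hq.star).toLp _ with hg
  have hgq : g =ᵐ[circleMeasure] star q := hq.star.coeFn_toLp
  have hzero : ∀ y : K1, inner ℂ g y = 0 := by
    refine isClosed_property hd (isClosed_eq (by fun_prop) continuous_const) fun f => ?_
    rw [L2.inner_def, ← h f]
    refine integral_congr_ae ?_
    filter_upwards [hgq] with k hk
    simp [hk, mul_comm]
  have hg0 : g = 0 := inner_self_eq_zero.1 (hzero g)
  refine hq0 ?_
  have h0 : g =ᵐ[circleMeasure] 0 := by rw [hg0]; exact Lp.coeFn_zero ℂ 2 circleMeasure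
  filter_upwards [hgq, h0] with k h1 h2
  have : star (q k) = 0 := by rw [← Pi.star_apply, ← h1, h2]; rfl
  simpa using this

theorem memLp_of_continuous {p : ℝ → ℂ} (hp : Continuous p) : MemLp p 2 circleMeasure := by
  obtain ⟨C, hC⟩ := isCompact_Icc.exists_bound_of_continuousOn
    (s := Icc 0 (2 * Real.pi)) hp.continuousOn
  refine MemLp.of_bound hp.aestronglyMeasurable C ?_
  rw [ae_circleMeasure_iff_volume]
  exact Filter.Eventually.of_forall fun k hk => hC k (Ioo_subset_Icc_self hk)

theorem not_ae_eq_zero_of_ae_ne {q : ℝ → ℂ} (h : ∀ᵐ k ∂circleMeasure, q k ≠ 0) :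
    ¬ q =ᵐ[circleMeasure] 0 := fun h0 => by
  obtain ⟨k, h1, h2⟩ := (h.and h0).exists
  exact h1 h2

section spectrum

variable {v φ : ℝ → ℝ} {z w : ℂ}

theorem phaseWeight_two_pi (hv2 : v 0 = v (2 * Real.pi))
    (hw : w = Complex.exp (Complex.I * z * ((φ (2 * Real.pi) : ℂ) - φ 0))) :
    w * phaseWeight v φ z (2 * Real.pi) = phaseWeight v φ z 0 := by
  rw [hw, phaseWeight, phaseWeight, hv2, mul_left_comm, ← Complex.exp_add]
  ring_nf

/-- If the total phase satisfies `exp(i z (φ(2π) - φ(0))) = 1`, the integrating factor is periodic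
and annihilates the range of `T - z`. -/
theorem mem_opSpectrum_of_exp_eq_one (hv : ContDiff ℝ 1 v) (hφ : ∀ k, HasDerivAt φ (v k) k)
    (hZ : {k ∈ Icc 0 (2 * Real.pi) | v k = 0}.Countable) (hv2 : v 0 = v (2 * Real.pi))
    (hz : Complex.exp (Complex.I * z * ((φ (2 * Real.pi) : ℂ) - φ 0)) = 1) :
    z ∈ opSpectrum (symOp v) := by
  have hφ1 : ContDiff ℝ 1 φ := contDiff_one_of_hasDerivAt hv.continuous hφ
  refine mem_opSpectrum_of_annihilator (q := phaseWeight v φ z)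
    (memLp_of_continuous (continuous_phaseWeight hv.continuous hφ1.continuous)) ?_ fun f => ?_
  · refine not_ae_eq_zero_of_ae_ne ?_
    filter_upwards [ae_ne_zero_of_countable hZ] with k hk using phaseWeight_ne_zero hk
  · obtain ⟨G, -, hG, -, hI⟩ := exists_continuous_quotient hv hφ hZ z f
    rw [integral_circleMeasure, hI _ (right_mem_Icc.2 Real.two_pi_pos.le),
      ← phaseWeight_two_pi hv2 hz.symm, hG]
    simp

/-- If `v` has a zero `k₀`, then the integrating factor, rescaled by a constant on one side
of `k₀` so as to match at the endpoints, annihilates the range of `T - z`, for every `z`. -/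
theorem mem_opSpectrum_of_zero (hv : ContDiff ℝ 1 v) (hφ : ∀ k, HasDerivAt φ (v k) k)
    (hZ : {k ∈ Icc 0 (2 * Real.pi) | v k = 0}.Countable) (hv2 : v 0 = v (2 * Real.pi))
    {k₀ : ℝ} (hk₀ : k₀ ∈ Icc 0 (2 * Real.pi)) (hk₀v : v k₀ = 0) :
    z ∈ opSpectrum (symOp v) := by
  have hφ1 : ContDiff ℝ 1 φ := contDiff_one_of_hasDerivAt hv.continuous hφ
  have hcont := continuous_phaseWeight (z := z) hv.continuous hφ1.continuous
  set ρ := phaseWeight v φ z with hρ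
  set w : ℂ := Complex.exp (Complex.I * z * ((φ (2 * Real.pi) : ℂ) - φ 0)) with hw
  set q : ℝ → ℂ := fun k => if k ≤ k₀ then ρ k else w * ρ k with hq
  -- The two branches of `q` agree at `k₀`, where both vanish.
  have hqc : Continuous q := by
    refine Continuous.if_le hcont (by fun_prop) continuous_id continuous_const ?_
    rintro k rfl
    rw [hρ, phaseWeight_eq_zero hk₀v, mul_zero]
  refine mem_opSpectrum_of_annihilator (memLp_of_continuous hqc) ?_ fun f => ?_
  · refine not_ae_eq_zero_of_ae_ne ?_
    filter_upwards [ae_ne_zero_of_countable hZ] with k hk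
    simp only [hq]
    split_ifs
    · exact phaseWeight_ne_zero hk
    · exact mul_ne_zero (Complex.exp_ne_zero _) (phaseWeight_ne_zero hk)
  · obtain ⟨G, -, hG, -, hI⟩ := exists_continuous_quotient hv hφ hZ z f
    set h : K1 := symOp v f - z • (f : K1)
    have hint := intervalIntegrable_continuous_mul hcont h
    have hqint := intervalIntegrable_continuous_mul hqc h
    have hsub : ∀ {a b : ℝ}, a ∈ Icc 0 (2 * Real.pi) → b ∈ Icc 0 (2 * Real.pi) →
        uIcc a b ⊆ uIcc 0 (2 * Real.pi) := fun ha hb => by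
      rw [uIcc_of_le Real.two_pi_pos.le]; exact uIcc_subset_Icc ha hb
    have h0 : (0 : ℝ) ∈ Icc 0 (2 * Real.pi) := left_mem_Icc.2 Real.two_pi_pos.le
    have h2 : (2 * Real.pi) ∈ Icc 0 (2 * Real.pi) := right_mem_Icc.2 Real.two_pi_pos.le
    have e1 : ∫ k in 0..k₀, q k * h k = ∫ k in 0..k₀, ρ k * h k := by
      refine intervalIntegral.integral_congr_ae (Filter.Eventually.of_forall fun k hk => ?_)
      rw [uIoc_of_le hk₀.1] at hk
      simp only [hq, if_pos hk.2]
    have e2 : ∫ k in k₀..2 * Real.pi, q k * h k =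
        w * ∫ k in k₀..2 * Real.pi, ρ k * h k := by
      rw [← intervalIntegral.integral_const_mul]
      refine intervalIntegral.integral_congr_ae (Filter.Eventually.of_forall fun k hk => ?_)
      rw [uIoc_of_le hk₀.2] at hk
      simp only [hq, if_neg (not_le.2 hk.1), mul_assoc]
    have i1 := hI k₀ hk₀
    have i2 := hI _ h2
    rw [← hρ] at i1 i2
    rw [← intervalIntegral.integral_add_adjacent_intervals (hint.mono_set (hsub h0 hk₀))
      (hint.mono_set (hsub hk₀ h2)), i1] at i2
    have hρ0 : ρ k₀ = 0 := phaseWeight_eq_zero hk₀v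
    have hper : w * ρ (2 * Real.pi) = ρ 0 := phaseWeight_two_pi hv2 hw
    rw [integral_circleMeasure, ← intervalIntegral.integral_add_adjacent_intervals
      (hqint.mono_set (hsub h0 hk₀)) (hqint.mono_set (hsub hk₀ h2)), e1, e2, i1]
    rw [smul_eq_zero]
    right
    rw [hρ0] at i2 ⊢
    rw [hG] at i2 ⊢
    linear_combination w * i2 - Complex.I * G (2 * Real.pi) * hper

end spectrum

/-! ### Points of the resolvent set -/

theorem norm_intervalIntegral_mul_le {p : ℝ → ℂ} (hp : Continuous p) {M : ℝ}
    (hM : ∀ k ∈ Icc 0 (2 * Real.pi), ‖p k‖ ≤ M) (h : K1) {x : ℝ}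
    (hx : x ∈ Icc 0 (2 * Real.pi)) :
    ‖∫ k in 0..x, p k * h k‖ ≤ 2 * Real.pi * M * ‖h‖ := by
  have hint := intervalIntegrable_continuous_mul hp h
  have hh : Integrable h circleMeasure := (Lp.memLp h).integrable one_le_two
  have hhi : IntervalIntegrable (fun k => (‖h k‖ : ℂ)) volume 0 (2 * Real.pi) :=
    integrable_circleMeasure_iff.1 hh.norm.ofReal
  have hhi' : IntervalIntegrable (fun k => ‖h k‖) volume 0 (2 * Real.pi) :=
    (integrable_circleMeasure_iff.1 hh).norm
  have h1 : ∫ k, ‖h k‖ ∂circleMeasure ≤ ‖h‖ := by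
    rw [integral_norm_eq_lintegral_enorm hh.aestronglyMeasurable, Lp.norm_def,
      ← eLpNorm_one_eq_lintegral_enorm]
    exact ENNReal.toReal_mono (Lp.eLpNorm_ne_top h)
      (eLpNorm_le_eLpNorm_of_exponent_le one_le_two hh.aestronglyMeasurable)
  have h2 : ∫ k in 0..2 * Real.pi, ‖h k‖ = 2 * Real.pi * ∫ k, ‖h k‖ ∂circleMeasure := by
    have := integral_circleMeasure fun k => (‖h k‖ : ℂ)
    rw [integral_complex_ofReal, intervalIntegral.integral_ofReal, Complex.real_smul] at this
    have h3 : ∫ k, ‖h k‖ ∂circleMeasure = (2 * Real.pi)⁻¹ * ∫ k in 0..2 * Real.pi, ‖h k‖ := by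
      exact_mod_cast this
    rw [h3, mul_inv_cancel_left₀ Real.two_pi_pos.ne']
  have hM0 : 0 ≤ M := (norm_nonneg _).trans (hM 0 (left_mem_Icc.2 Real.two_pi_pos.le))
  calc ‖∫ k in 0..x, p k * h k‖ ≤ ∫ k in 0..x, ‖p k * h k‖ :=
        intervalIntegral.norm_integral_le_integral_norm hx.1
    _ ≤ ∫ k in 0..2 * Real.pi, ‖p k * h k‖ :=
        intervalIntegral.integral_mono_interval le_rfl hx.1 hx.2
          (Filter.Eventually.of_forall fun k => norm_nonneg _) hint.norm
    _ ≤ ∫ k in 0..2 * Real.pi, M * ‖h k‖ := by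
        refine intervalIntegral.integral_mono_on Real.two_pi_pos.le hint.norm
          (hhi'.const_mul M) fun k hk => ?_
        rw [norm_mul]
        exact mul_le_mul_of_nonneg_right (hM k hk) (norm_nonneg _)
    _ = 2 * Real.pi * M * ∫ k, ‖h k‖ ∂circleMeasure := by
        rw [intervalIntegral.integral_const_mul, h2]; ring
    _ ≤ 2 * Real.pi * M * ‖h‖ := by
        have := Real.two_pi_pos
        gcongr

theorem isACRep_of_contDiff {f : K1} {F : ℝ → ℂ} (hF : ContDiff ℝ 1 F)
    (hper : F 0 = F (2 * Real.pi)) (hf : f =ᵐ[circleMeasure] F) : IsACRep f F where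
  ac := hF.contDiffOn.absolutelyContinuousOnInterval
  periodic := hper
  deriv_memLp := memLp_of_continuous (hF.continuous_deriv le_rfl)
  ae_eq := hf

section nonvanishing

variable {v φ : ℝ → ℝ} {z : ℂ}

/-- If `v` has no zeros, `T` acts on `v G`, with `G` of class `C¹` and `G(0) = G(2π)`, by the
expected differential expression. -/
theorem exists_mem_symOp_domain (hv : ContDiff ℝ 1 v) (hv0 : ∀ k, v k ≠ 0)
    (hv2 : v 0 = v (2 * Real.pi)) {G : ℝ → ℂ} (hG : ContDiff ℝ 1 G)
    (hG2 : G 0 = G (2 * Real.pi)) :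
    ∃ f : (symOp v).domain, (f : K1) =ᵐ[circleMeasure] (fun k => v k * G k) ∧
      symOp v f =ᵐ[circleMeasure]
        fun k => -Complex.I * (deriv G k + (deriv v k / v k / 2 : ℝ) * G k) := by
  have hvc : ContDiff ℝ 1 (fun k => (v k : ℂ)) := Complex.ofRealCLM.contDiff.comp hv
  have hv0' : ∀ k, (v k : ℂ) ≠ 0 := fun k => by exact_mod_cast hv0 k
  set F : ℝ → ℂ := fun k => v k * G k with hF
  have hF1 : ContDiff ℝ 1 F := hvc.mul hG
  have hFm := memLp_of_continuous hF1.continuous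
  set f : K1 := hFm.toLp F
  have hfF : f =ᵐ[circleMeasure] F := hFm.coeFn_toLp
  have hrep : IsACRep f F := isACRep_of_contDiff hF1 (by simp only [hF, hv2, hG2]) hfF
  have hquot : (fun k => ((1 / v k : ℝ) : ℂ) * f k) =ᵐ[circleMeasure] G := by
    filter_upwards [hfF] with k hk
    rw [hk, hF]
    have := hv0' k
    push_cast
    field_simp
  have hinv : Continuous fun k => ((1 / v k : ℝ) : ℂ) :=
    Complex.continuous_ofReal.comp (continuous_const.div hv.continuous hv0)
  have hP : f ∈ momentum.domain := ⟨F, hrep⟩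
  have hP' : momentum ⟨f, hP⟩ ∈ (mulOp fun k => ((1 / v k : ℝ) : ℂ)).domain := by
    have h1 : MemLp (fun k => ((1 / v k : ℝ) : ℂ) * (-Complex.I * deriv F k)) 2 circleMeasure :=
      memLp_of_continuous (hinv.mul (continuous_const.mul (hF1.continuous_deriv le_rfl)))
    refine h1.ae_eq ?_
    filter_upwards [momentum_apply_ae hrep hP] with k hk
    rw [hk]
  have hM : f ∈ (mulOp fun k => ((1 / v k : ℝ) : ℂ)).domain :=
    (memLp_of_continuous hG.continuous).ae_eq hquot.symm
  have hGrep : IsACRep (mulOp (fun k => ((1 / v k : ℝ) : ℂ)) ⟨f, hM⟩) G :=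
    isACRep_of_contDiff hG hG2 ((mulOp_apply_ae ⟨f, hM⟩).trans hquot)
  refine ⟨⟨f, mem_symOp_domain.2 ⟨⟨hP, hP'⟩, hM, ⟨G, hGrep⟩⟩⟩, hfF, ?_⟩
  filter_upwards [symOp_apply_ae ⟨f, mem_symOp_domain.2 ⟨⟨hP, hP'⟩, hM, ⟨G, hGrep⟩⟩⟩ hrep hGrep]
    with k hk
  have hdF : deriv F k = (deriv v k : ℝ) * G k + v k * deriv G k :=
    ((((hv.differentiable one_ne_zero) k).hasDerivAt.ofReal_comp).mul
      ((hG.differentiable one_ne_zero) k).hasDerivAt).deriv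
  rw [hk, hdF]
  have := hv0' k
  push_cast
  field_simp
  ring

/-- Every continuous function is in the range of `T - z`: the equation is solved by the variation
of constants formula, with the constant fixed by the periodic boundary condition. -/
theorem exists_apply_sub_smul_ae_eq (hv : ContDiff ℝ 1 v) (hφ : ∀ k, HasDerivAt φ (v k) k)
    (hv0 : ∀ k, v k ≠ 0) (hv2 : v 0 = v (2 * Real.pi))
    (hz : Complex.exp (Complex.I * z * ((φ (2 * Real.pi) : ℂ) - φ 0)) ≠ 1)
    {h : ℝ → ℂ} (hh : Continuous h) :
    ∃ f : (symOp v).domain, (symOp v f - z • (f : K1) : K1) =ᵐ[circleMeasure] h := by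
  have hφ1 : ContDiff ℝ 1 φ := contDiff_one_of_hasDerivAt hv.continuous hφ
  set ρ := phaseWeight v φ z with hρ
  set w : ℂ := Complex.exp (Complex.I * z * ((φ (2 * Real.pi) : ℂ) - φ 0)) with hw
  have hρ1 : ContDiff ℝ 1 ρ := contDiff_iff_contDiffAt.2 fun k =>
    contDiffAt_phaseWeight hv hφ1 (hv0 k)
  have hρ0 : ∀ k, ρ k ≠ 0 := fun k => phaseWeight_ne_zero (hv0 k)
  have hper : w * ρ (2 * Real.pi) = ρ 0 := phaseWeight_two_pi hv2 hw
  have hρh : Continuous fun k => ρ k * h k := hρ1.continuous.mul hh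
  have hJ : ∀ x, HasDerivAt (fun x => ∫ k in 0..x, ρ k * h k) (ρ x * h x) x := fun x =>
    intervalIntegral.integral_hasDerivAt_right (hρh.intervalIntegrable _ _)
      (hρh.stronglyMeasurableAtFilter _ _) hρh.continuousAt
  set b₀ : ℂ := Complex.I * w * (∫ k in 0..2 * Real.pi, ρ k * h k) / (1 - w) with hb₀
  set b : ℝ → ℂ := fun x => b₀ + Complex.I * ∫ k in 0..x, ρ k * h k with hb
  have hbd : ∀ x, HasDerivAt b (Complex.I * (ρ x * h x)) x := fun x =>
    ((hJ x).const_mul Complex.I).const_add b₀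
  have hb1 : ContDiff ℝ 1 b := by
    rw [contDiff_one_iff_deriv]
    refine ⟨fun x => (hbd x).differentiableAt, ?_⟩
    rw [show deriv b = fun x => Complex.I * (ρ x * h x) from funext fun x => (hbd x).deriv]
    exact continuous_const.mul hρh
  have hb2 : w * b (2 * Real.pi) = b 0 := by
    have : 1 - w ≠ 0 := sub_ne_zero.2 hz.symm
    simp only [hb, intervalIntegral.integral_same, mul_zero, add_zero, hb₀]
    field_simp
    ring
  have hG : ContDiff ℝ 1 (fun x => b x / ρ x) := by
    simp only [div_eq_mul_inv]
    exact hb1.mul (hρ1.inv hρ0)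
  obtain ⟨f, hf, hTf⟩ := exists_mem_symOp_domain hv hv0 hv2 hG (by
    rw [div_eq_div_iff (hρ0 _) (hρ0 _), ← hb2, ← hper]
    ring)
  refine ⟨f, ?_⟩
  filter_upwards [coeFn_sub_smul (symOp v f) f z, hf, hTf] with k h1 h2 h3
  have hρd : HasDerivAt ρ
      (ρ k * (((deriv v k / v k / 2 : ℝ) : ℂ) - Complex.I * z * v k)) k :=
    hasDerivAt_phaseWeight hv hφ (hv0 k)
  have hGd : deriv (fun x => b x / ρ x) k = _ := ((hbd k).div hρd (hρ0 k)).deriv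
  rw [h1, h2, h3, hGd]
  have := hρ0 k
  field_simp
  ring_nf
  simp only [Complex.I_sq]
  ring

/-- `T - z` is bounded below: by the integrated equation and the periodic boundary condition, the
supremum of `f` is controlled by the `L²` norm of `(T - z) f`. -/
theorem exists_bound_apply_sub_smul (hv : ContDiff ℝ 1 v) (hφ : ∀ k, HasDerivAt φ (v k) k)
    (hv0 : ∀ k, v k ≠ 0) (hv2 : v 0 = v (2 * Real.pi))
    (hz : Complex.exp (Complex.I * z * ((φ (2 * Real.pi) : ℂ) - φ 0)) ≠ 1) :
    ∃ C : ℝ, 0 < C ∧ ∀ f : (symOp v).domain,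
      ‖(f : K1)‖ ≤ C * ‖symOp v f - z • (f : K1)‖ := by
  have hφ1 : ContDiff ℝ 1 φ := contDiff_one_of_hasDerivAt hv.continuous hφ
  set ρ := phaseWeight v φ z with hρ
  set w : ℂ := Complex.exp (Complex.I * z * ((φ (2 * Real.pi) : ℂ) - φ 0)) with hw
  have hρc : Continuous ρ := continuous_phaseWeight hv.continuous hφ1.continuous
  have hρ0 : ∀ k, ρ k ≠ 0 := fun k => phaseWeight_ne_zero (hv0 k)
  have hper : w * ρ (2 * Real.pi) = ρ 0 := phaseWeight_two_pi hv2 hw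
  have hw1 : 0 < ‖1 - w‖ := norm_pos_iff.2 (sub_ne_zero.2 hz.symm)
  have hpi := Real.two_pi_pos
  obtain ⟨M, hM⟩ := isCompact_Icc.exists_bound_of_continuousOn
    (s := Icc 0 (2 * Real.pi)) hρc.continuousOn
  obtain ⟨N, hN⟩ := isCompact_Icc.exists_bound_of_continuousOn
    (s := Icc 0 (2 * Real.pi)) (f := fun k => (v k : ℂ) / ρ k)
    ((Complex.continuous_ofReal.comp hv.continuous).div hρc hρ0).continuousOn
  have h0m : (0 : ℝ) ∈ Icc 0 (2 * Real.pi) := left_mem_Icc.2 hpi.le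
  have hM0 : 0 ≤ M := (norm_nonneg _).trans (hM 0 h0m)
  have hN0 : 0 ≤ N := (norm_nonneg _).trans (hN 0 h0m)
  set L : ℝ := 2 * Real.pi * M with hL
  have hL0 : 0 ≤ L := by positivity
  refine ⟨N * (‖w‖ / ‖1 - w‖ * L + L) + 1, by positivity, fun f => ?_⟩
  obtain ⟨G, -, hG2, hfG, hI⟩ := exists_continuous_quotient hv hφ
    (by simp [hv0]) z f
  set h : K1 := symOp v f - z • (f : K1)
  have hint : ∀ x ∈ Icc 0 (2 * Real.pi), ‖∫ k in 0..x, ρ k * h k‖ ≤ L * ‖h‖ := fun x hx =>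
    norm_intervalIntegral_mul_le hρc hM h hx
  rw [← hρ] at hI
  have hstart : ‖ρ 0 * G 0‖ ≤ ‖w‖ / ‖1 - w‖ * (L * ‖h‖) := by
    have e : (1 - w) * (ρ 0 * G 0) = Complex.I * (w * ∫ k in 0..2 * Real.pi, ρ k * h k) := by
      rw [hI _ (right_mem_Icc.2 hpi.le), ← hG2]
      linear_combination (ρ (2 * Real.pi) * G 0 * w - ρ 0 * G 0 * w) * Complex.I_sq - G 0 * hper
    have e' := congrArg norm e
    rw [norm_mul (1 - w), norm_mul Complex.I, norm_mul w, Complex.norm_I, one_mul] at e'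
    rw [div_mul_eq_mul_div, le_div_iff₀ hw1, mul_comm, e']
    exact mul_le_mul_of_nonneg_left (hint _ (right_mem_Icc.2 hpi.le)) (norm_nonneg _)
  have hsup : ∀ᵐ k ∂circleMeasure,
      ‖(f : K1) k‖ ≤ N * (‖w‖ / ‖1 - w‖ * L + L) * ‖h‖ := by
    have hmem : ∀ᵐ k ∂circleMeasure, k ∈ Ioo 0 (2 * Real.pi) :=
      ae_circleMeasure_iff_volume.2 (Filter.Eventually.of_forall fun k hk => hk)
    filter_upwards [hfG, hmem] with k hk hk'
    have hkm := Ioo_subset_Icc_self hk'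
    have hB : ‖ρ k * G k‖ ≤ ‖w‖ / ‖1 - w‖ * (L * ‖h‖) + L * ‖h‖ := by
      have e : ρ k * G k = ρ 0 * G 0 + Complex.I * ∫ k in 0..k, ρ k * h k := by
        rw [hI k hkm]
        linear_combination (ρ k * G k - ρ 0 * G 0) * Complex.I_sq
      rw [e]
      refine (norm_add_le _ _).trans (add_le_add hstart ?_)
      rw [norm_mul, Complex.norm_I, one_mul]
      exact hint k hkm
    have e : (v k : ℂ) * G k = v k / ρ k * (ρ k * G k) := by
      have := hρ0 k
      field_simp
    rw [hk, e, norm_mul]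
    calc _ ≤ N * (‖w‖ / ‖1 - w‖ * (L * ‖h‖) + L * ‖h‖) :=
          mul_le_mul (hN k hkm) hB (norm_nonneg _) hN0
      _ = _ := by ring
  have hnorm := Lp.norm_le_of_ae_bound (p := 2) (f := (f : K1)) (by positivity) hsup
  have hone : measureUnivNNReal circleMeasure = 1 := by
    simp [measureUnivNNReal]
  rw [hone] at hnorm
  simp only [NNReal.coe_one, Real.one_rpow, one_mul] at hnorm
  nlinarith [norm_nonneg h]

theorem mem_resolvent_of_exp_ne_one (hv : ContDiff ℝ 1 v) (hφ : ∀ k, HasDerivAt φ (v k) k)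
    (hv0 : ∀ k, v k ≠ 0) (hv2 : v 0 = v (2 * Real.pi))
    (hz : Complex.exp (Complex.I * z * ((φ (2 * Real.pi) : ℂ) - φ 0)) ≠ 1) :
    z ∈ resolvent (symOp v) := by
  constructor
  · have hp : (2 : ℝ≥0∞) ≠ ∞ := ENNReal.ofNat_ne_top
    have hd := BoundedContinuousFunction.toLp_denseRange (α := ℝ) ℂ circleMeasure ℂ hp
    refine hd.mono ?_
    rintro _ ⟨h, rfl⟩
    obtain ⟨f, hf⟩ := exists_apply_sub_smul_ae_eq hv hφ hv0 hv2 hz h.continuous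
    exact ⟨f, Lp.ext (hf.trans (BoundedContinuousFunction.coeFn_toLp 2 circleMeasure ℂ h).symm)⟩
  · obtain ⟨C, hC, h⟩ := exists_bound_apply_sub_smul hv hφ hv0 hv2 hz
    refine ⟨C⁻¹, inv_pos.2 hC, fun f => ?_⟩
    rw [inv_mul_le_iff₀ hC]
    exact h f

end nonvanishing

/-! ### Regularity of the phase -/

/-- A continuous phase of a `C^n` function is `C^n`: near each point it is a branch of the
logarithm. -/
theorem contDiff_of_exp_eq {lam : ℝ → ℂ} {φ : ℝ → ℝ} {n : WithTop ℕ∞} (hlam : ContDiff ℝ n lam)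
    (hφ : Continuous φ) (h : ∀ k, lam k = Complex.exp (Complex.I * φ k)) : ContDiff ℝ n φ := by
  refine contDiff_iff_contDiffAt.2 fun k₀ => ?_
  have hne : lam k₀ ≠ 0 := by rw [h]; exact Complex.exp_ne_zero _
  have hloc : φ =ᶠ[nhds k₀] fun k => φ k₀ + Complex.imCLM (Complex.log (lam k / lam k₀)) := by
    have hev : ∀ᶠ k in nhds k₀, φ k ∈ Ioo (φ k₀ - Real.pi) (φ k₀ + Real.pi) :=
      hφ.continuousAt.eventually_mem
        (Ioo_mem_nhds (by linarith [Real.pi_pos]) (by linarith [Real.pi_pos]))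
    filter_upwards [hev] with k hk
    have him : (Complex.I * φ k - Complex.I * φ k₀).im = φ k - φ k₀ := by simp
    rw [h, h, ← Complex.exp_sub, Complex.log_exp (by rw [him]; linarith [hk.1])
      (by rw [him]; linarith [hk.2]), Complex.imCLM_apply, him]
    ring
  refine ContDiffAt.congr_of_eventuallyEq ?_ hloc
  have hdiv : ContDiffAt ℝ n (fun k => lam k / lam k₀) k₀ := hlam.contDiffAt.div_const _
  have hlog : ContDiffAt ℝ n (fun k => Complex.log (lam k / lam k₀)) k₀ :=
    ((Complex.contDiffAt_log
      (by rw [div_self hne]; exact Complex.one_mem_slitPlane)).restrict_scalars ℝ).comp k₀ hdiv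
  exact contDiffAt_const.add (Complex.imCLM.contDiff.contDiffAt.comp k₀ hlog)

theorem timeOp_eq_symOp (m : ℤ) (θ : ℝ → ℝ) : timeOp m θ = symOp fun k => m + deriv θ k := rfl

theorem exp_two_pi_mul_eq_one_iff {m : ℤ} (hm : m ≠ 0) {z : ℂ} :
    Complex.exp (Complex.I * z * (m * (2 * Real.pi))) = 1 ↔ ∃ s : ℤ, z = (s : ℂ) / (m : ℂ) := by
  have hm' : (m : ℂ) ≠ 0 := by exact_mod_cast hm
  rw [Complex.exp_eq_one_iff]
  refine exists_congr fun s => ?_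
  rw [eq_div_iff hm']
  constructor
  · intro h
    refine mul_right_cancel₀ Complex.two_pi_I_ne_zero ?_
    linear_combination h
  · intro h
    linear_combination (2 * Real.pi * Complex.I) * h

end QuantumWalk

end

theorem mainTheorem2 (lam : ℝ → ℂ) (hlam_norm : ∀ k : ℝ, ‖lam k‖ = 1)
    (hlam_smooth : ContDiff ℝ 2 lam)
    (hlam_periodic : Function.Periodic lam (2 * Real.pi))
    (hlam_zeros : {k : ℝ | k ∈ Set.Ico 0 (2 * Real.pi) ∧ deriv lam k = 0}.Finite)
    (m : ℤ) (θ : ℝ → ℝ) (hθ : QuantumWalk.IsWindingData lam m θ) :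
    ((∀ k : ℝ, deriv lam k ≠ 0) →
      m ≠ 0 ∧ QuantumWalk.opSpectrum (QuantumWalk.timeOp m θ) =
        {z : ℂ | ∃ s : ℤ, z = (s : ℂ) / (m : ℂ)}) ∧
    ((∃ k : ℝ, deriv lam k = 0) →
      QuantumWalk.opSpectrum (QuantumWalk.timeOp m θ) = Set.univ) := by
  set φ : ℝ → ℝ := fun k => m * k + θ k with hφdef
  set v : ℝ → ℝ := fun k => m + deriv θ k with hvdef
  have hlamφ : ∀ k, lam k = Complex.exp (Complex.I * φ k) := hθ.eq_exp
  have hφC : ContDiff ℝ 2 φ := QuantumWalk.contDiff_of_exp_eq hlam_smooth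
    ((continuous_const.mul continuous_id).add hθ.continuous) hlamφ
  have hθC : ContDiff ℝ 2 θ := by
    have : ContDiff ℝ 2 fun k => φ k - m * k := hφC.sub (contDiff_const.mul contDiff_id)
    simpa [hφdef] using this
  have hθd : ∀ k, HasDerivAt θ (deriv θ k) k := fun k =>
    ((hθC.differentiable two_ne_zero) k).hasDerivAt
  have hφd : ∀ k, HasDerivAt φ (v k) k := fun k =>
    (((hasDerivAt_id k).const_mul (m : ℝ)).add (hθd k)).congr_deriv (by simp [hvdef])
  have hv : ContDiff ℝ 1 v :=
    contDiff_const.add ((contDiff_succ_iff_deriv (n := 1)).1 hθC).2.2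
  have hv_per : Function.Periodic v (2 * Real.pi) := fun k => by
    have : deriv θ (k + 2 * Real.pi) = deriv θ k := by
      rw [← deriv_comp_add_const, hθ.periodic.funext]
    simp only [hvdef, this]
  have hv2 : v 0 = v (2 * Real.pi) := by simpa using (hv_per 0).symm
  have hphase : ((φ (2 * Real.pi) : ℂ) - φ 0) = m * (2 * Real.pi) := by
    have h0 : θ (2 * Real.pi) = θ 0 := by simpa using hθ.periodic 0
    simp only [hφdef, h0]
    push_cast
    ring
  have hzero : ∀ k, deriv lam k = 0 ↔ v k = 0 := fun k => by
    have h1 : deriv lam k = Complex.exp (Complex.I * φ k) * (Complex.I * v k) := by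
      rw [show lam = fun k => Complex.exp (Complex.I * φ k) from funext hlamφ]
      exact (((hφd k).ofReal_comp.const_mul Complex.I).cexp).deriv
    rw [h1]
    simp [Complex.exp_ne_zero]
  have hZ : {k ∈ Set.Icc 0 (2 * Real.pi) | v k = 0}.Countable := by
    refine (hlam_zeros.insert (2 * Real.pi)).countable.mono ?_
    rintro k ⟨hk, hk0⟩
    rcases hk.2.eq_or_lt with h | h
    · exact Or.inl h
    · exact Or.inr ⟨⟨hk.1, h⟩, (hzero k).2 hk0⟩
  rw [QuantumWalk.timeOp_eq_symOp]
  constructor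
  · intro hne
    have hv0 : ∀ k, v k ≠ 0 := fun k hk => hne k ((hzero k).2 hk)
    -- For `m = 0`, Rolle's theorem for the periodic function `θ` gives a zero of `v = θ'`.
    have hm : m ≠ 0 := by
      rintro rfl
      obtain ⟨c, -, hc⟩ := exists_deriv_eq_zero Real.two_pi_pos hθ.continuous.continuousOn
        (by simpa using (hθ.periodic 0).symm)
      exact hv0 c (by simp [hvdef, hc])
    refine ⟨hm, Set.ext fun z => ?_⟩
    rw [Set.mem_ofPred_eq, ← QuantumWalk.exp_two_pi_mul_eq_one_iff hm, ← hphase]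
    refine ⟨fun h => ?_, fun h => QuantumWalk.mem_opSpectrum_of_exp_eq_one hv hφd hZ hv2 h⟩
    by_contra hz
    exact h (QuantumWalk.mem_resolvent_of_exp_ne_one hv hφd hv0 hv2 hz)
  · rintro ⟨k, hk⟩
    obtain ⟨k₀, hk₀, hvk⟩ := hv_per.exists_mem_Ico₀ Real.two_pi_pos k
    refine Set.eq_univ_of_forall fun z => ?_
    exact QuantumWalk.mem_opSpectrum_of_zero hv hφd hZ hv2 (Set.Ico_subset_Icc_self hk₀)
      (hvk.symm.trans ((hzero k).1 hk))
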